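/- Let $n\ge 5$ and let $P$ be a convex $n$-gon with labelled vertices. Let $\mathcal{A}_n$ be the associahedron (flip) graph of $P$: its vertices are the triangulations of $P$ (the sets of $n-3$ pairwise non-crossing diagonals of $P$), and two distinct triangulations are adjacent if and only if they have exactly $n-4$ diagonals in common. Then the smallest eigenvalue $\lambda_{\min}(\mathcal{A}_n)$ of the adjacency matrix of $\mathcal{A}_n$ satisfies $$\lambda_{\min}(\mathcal{A}_n)\;\ge\;-\frac{5+\sqrt5}{8}\,(n-3)-\frac{3-\sqrt5}{8}.$$ -/

import Mathlib

namespace Associahedron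

/-- The vertices of the convex `n`-gon are labelled `0, 1, ..., n - 1` in cyclic order (`Fin n`).
The pair `(i, j)` is a diagonal when `i < j` and the vertices `i`, `j` are not consecutive on the
polygon: neither `j = i + 1`, nor `i = 0` and `j = n - 1`. Each diagonal is represented by exactly
one such pair. -/
def IsDiagonal {n : ℕ} (d : Fin n × Fin n) : Prop :=
  d.1.val + 1 < d.2.val ∧ ¬ (d.1.val = 0 ∧ d.2.val + 1 = n)

/-- Two diagonals of a convex polygon cross (meet in their interiors, without coinciding) exactly
when their endpoints strictly alternate around the polygon. -/
def Cross {n : ℕ} (d e : Fin n × Fin n) : Prop :=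
  (d.1 < e.1 ∧ e.1 < d.2 ∧ d.2 < e.2) ∨ (e.1 < d.1 ∧ d.1 < e.2 ∧ e.2 < d.2)

/-- A triangulation of the convex `n`-gon (`n ≥ 3`): a set of `n - 3` pairwise non-crossing
diagonals. -/
def IsTriangulation {n : ℕ} (T : Finset (Fin n × Fin n)) : Prop :=
  (∀ d ∈ T, IsDiagonal d) ∧ (∀ d ∈ T, ∀ e ∈ T, ¬ Cross d e) ∧ T.card = n - 3

instance {n : ℕ} (d : Fin n × Fin n) : Decidable (IsDiagonal d) := by
  unfold IsDiagonal; infer_instance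

instance {n : ℕ} (d e : Fin n × Fin n) : Decidable (Cross d e) := by
  unfold Cross; infer_instance

instance {n : ℕ} (T : Finset (Fin n × Fin n)) : Decidable (IsTriangulation T) := by
  unfold IsTriangulation; infer_instance

/-- The set of triangulations of the convex `n`-gon. -/
abbrev Triangulation (n : ℕ) : Type := {T : Finset (Fin n × Fin n) // IsTriangulation T}

/-- The associahedron (flip) graph, for `n ≥ 4`: two distinct triangulations of the convex `n`-gon
are adjacent when they share `n - 4` of their `n - 3` diagonals. -/
def associahedronGraph (n : ℕ) : SimpleGraph (Triangulation n) where
  Adj S T := S ≠ T ∧ (S.val ∩ T.val).card = n - 4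
  symm := ⟨fun S T h => ⟨h.1.symm, by rw [Finset.inter_comm]; exact h.2⟩⟩
  loopless := ⟨fun _ h => h.1 rfl⟩

instance (n : ℕ) : DecidableRel (associahedronGraph n).Adj := fun S T => by
  unfold associahedronGraph; infer_instance

/-- `μ` is the smallest eigenvalue of the (real) adjacency matrix of the finite graph `G`. -/
def IsSmallestEigenvalue {V : Type*} [Fintype V] [DecidableEq V] (G : SimpleGraph V)
    [DecidableRel G.Adj] (μ : ℝ) : Prop :=
  IsLeast {x : ℝ | Module.End.HasEigenvalue (Matrix.toLin' (G.adjMatrix ℝ)) x} μ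

end Associahedron

/-! The associahedron contains many 5-cycles: its pentagonal faces, each given by `n - 5`
noncrossing diagonals that leave one pentagon untriangulated. On a 5-cycle, `∑ (x i + x (i + 1)) ^
2` is at least `2 + 2 cos (4π/5) = (3 - √5)/2` times `∑ x i ^ 2` (`five_cycle_sq_add_ge`). This
inequality is summed over all faces, with `x` the restriction of a function `f` on triangulations.

Three counts turn the sum into a bound for the adjacency form. Every triangulation lies on at least
`n - 4` faces (`le_card_pentagons`): a face through `T` corresponds to two diagonals of `T` in a
common triangle, and the dual tree provides `n - 4` such pairs. Every flip lies on at most 4 faces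
(`card_pentagons_le`): the pentagon is the flip quadrilateral enlarged by a triangle across one of
its four sides. Every degree is at most `n - 3` (`degree_le`). Hence `(3 - √5)/2 * (n - 4) * ‖f‖² ≤
4 * ((n - 3) * ‖f‖² + ⟨f, A f⟩)`, and evaluating at an eigenvector gives the bound. -/

namespace Associahedron

/-! ### Noncrossing diagonals, flips and the degree bound. -/

section Combinatorics

variable {n : ℕ}

/-- `a < b` are joined in `T`: by a side of the polygon or by a diagonal of `T`. -/
def IsEdge (T : Finset (Fin n × Fin n)) (a b : Fin n) : Prop :=
  a.val + 1 = b.val ∨ (a.val = 0 ∧ b.val + 1 = n) ∨ (a, b) ∈ T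

theorem Cross.symm {d e : Fin n × Fin n} (h : Cross d e) : Cross e d := by
  unfold Cross at *; tauto

theorem not_cross_self (d : Fin n × Fin n) : ¬ Cross d d := by
  unfold Cross; simp only [Fin.lt_def]; omega

theorem IsEdge.not_cross {T : Finset (Fin n × Fin n)} {a b : Fin n} (h : IsEdge T a b)
    {z : Fin n × Fin n} (hz : ∀ e ∈ T, ¬ Cross z e) : ¬ Cross z (a, b) := by
  rcases h with h | h | h
  · unfold Cross; simp only [Fin.lt_def]; omega
  · unfold Cross; simp only [Fin.lt_def]; have := z.1.2; have := z.2.2; omega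
  · exact hz _ h

theorem IsEdge.mem {T : Finset (Fin n × Fin n)} {a b : Fin n} (h : IsEdge T a b)
    (hd : IsDiagonal (a, b)) : (a, b) ∈ T := by
  rcases h with h | h | h
  · have := hd.1; simp only at this; omega
  · exact absurd h hd.2
  · exact h

theorem IsEdge.mono {T U : Finset (Fin n × Fin n)} {a b : Fin n} (h : IsEdge T a b)
    (hU : (a, b) ∈ T → (a, b) ∈ U) : IsEdge U a b := by
  unfold IsEdge at *; tauto

/-- The largest apex of a triangle below `d` whose left side is an edge. -/
theorem exists_max_apex (F : Finset (Fin n × Fin n)) (d : Fin n × Fin n)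
    (hd : d.1.val + 1 < d.2.val) :
    ∃ k : Fin n, d.1 < k ∧ k < d.2 ∧ (d.1.val + 1 = k.val ∨ (d.1, k) ∈ F) ∧
      ∀ j, j < d.2 → (d.1, j) ∈ F → j ≤ k := by
  classical
  let s : Finset (Fin n) := Finset.univ.filter fun k => d.1 < k ∧ k < d.2 ∧
    (d.1.val + 1 = k.val ∨ (d.1, k) ∈ F)
  have hs : s.Nonempty := ⟨⟨d.1.val + 1, by omega⟩, by
    simp only [s, Finset.mem_filter, Finset.mem_univ, true_and, Fin.lt_def]
    exact ⟨by omega, hd, Or.inl trivial⟩⟩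
  obtain ⟨k, hk, hmax⟩ := s.exists_max_image id hs
  simp only [s, Finset.mem_filter, Finset.mem_univ, true_and, id] at hk hmax
  refine ⟨k, hk.1, hk.2.1, hk.2.2, fun j hj hjF => ?_⟩
  by_cases h : d.1 < j
  · exact hmax j ⟨h, hj, Or.inr hjF⟩
  · exact (not_lt.1 h).trans hk.1.le

/-- Sending each chord to its largest apex is injective into the `n - 2` vertices other than the
first and last. If two chords with different left ends shared an apex, the left side of one triangle
would cross the other chord; with equal left ends, the shorter chord would be a candidate for the
longer one and push its apex further right. The chord `(0, n - 1)` is allowed here, which is what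
sharpens the bound for genuine diagonals to `n - 3`. -/
theorem card_le_of_not_cross {F : Finset (Fin n × Fin n)}
    (hF : ∀ d ∈ F, d.1.val + 1 < d.2.val) (hc : ∀ d ∈ F, ∀ e ∈ F, ¬ Cross d e) :
    F.card ≤ n - 2 := by
  classical
  rcases F.eq_empty_or_nonempty with rfl | ⟨d₀, hd₀⟩
  · simp
  have : Nonempty (Fin n) := ⟨d₀.1⟩
  choose! m hm1 hm2 hm3 hm4 using fun d hd => exists_max_apex F d (hF d hd)
  have key : ∀ d ∈ F, ∀ e ∈ F, m d = m e → ¬ d.1 < e.1 := by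
    intro d hd e he h hlt
    have h1 := hm1 d hd
    have h2 := hm2 d hd
    have h1' := hm1 e he
    have h2' := hm2 e he
    rcases hm3 d hd with h3 | h3
    · simp only [Fin.lt_def, Fin.ext_iff] at *; omega
    · have := hc _ h3 _ he
      unfold Cross at this
      simp only [Fin.lt_def, Fin.ext_iff] at *
      omega
  have key2 : ∀ d ∈ F, ∀ e ∈ F, m d = m e → d.1 = e.1 → ¬ d.2 < e.2 := by
    intro d hd e he h h1 hlt
    have h2 := hm4 e he d.2 hlt (by rw [← h1]; exact hd)
    have h3 := hm2 d hd
    rw [h] at h3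
    exact absurd h3 (not_lt.2 h2)
  have hinj : Set.InjOn (fun d => (m d).val) (F : Set (Fin n × Fin n)) := by
    intro d hd e he h
    have h := Fin.ext h
    have h1 : d.1 = e.1 := le_antisymm (not_lt.1 (key e he d hd h.symm)) (not_lt.1 (key d hd e he h))
    exact Prod.ext h1 (le_antisymm (not_lt.1 (key2 e he d hd h.symm h1.symm))
      (not_lt.1 (key2 d hd e he h h1)))
  have := Finset.card_le_card_of_injOn (t := Finset.Ioo 0 (n - 1)) _ (fun d hd => by
    have h1 := hm1 d hd
    have h2 := hm2 d hd
    have := d.2.2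
    simp only [Fin.lt_def] at h1 h2
    simp only [Finset.coe_Ioo, Set.mem_Ioo]
    omega) hinj
  simp only [Nat.card_Ioo] at this
  omega

theorem card_le_of_isDiagonal {F : Finset (Fin n × Fin n)} (hn : 3 ≤ n)
    (hF : ∀ d ∈ F, IsDiagonal d) (hc : ∀ d ∈ F, ∀ e ∈ F, ¬ Cross d e) :
    F.card ≤ n - 3 := by
  classical
  let r : Fin n × Fin n := (⟨0, by omega⟩, ⟨n - 1, by omega⟩)
  have hr : r ∉ F := fun h => (hF r h).2 ⟨rfl, by simp [r]; omega⟩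
  have hcr : ∀ z, ¬ Cross z r := by
    intro z
    have := z.2.2
    unfold Cross; simp only [Fin.lt_def, r]; omega
  have := card_le_of_not_cross (F := insert r F)
    (by
      intro d hd
      rcases Finset.mem_insert.1 hd with rfl | hd
      · simp only [r]; omega
      · exact (hF d hd).1)
    (by
      intro d hd e he
      rcases Finset.mem_insert.1 hd with rfl | hd <;> rcases Finset.mem_insert.1 he with rfl | he
      · exact hcr _
      · exact fun h => hcr _ h.symm
      · exact hcr _
      · exact hc d hd e he)
  rw [Finset.card_insert_of_notMem hr] at this
  omega

namespace IsTriangulation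

variable {T : Finset (Fin n × Fin n)}

theorem mem_of_not_cross (hn : 3 ≤ n) (hT : IsTriangulation T) {d : Fin n × Fin n}
    (hd : IsDiagonal d) (hc : ∀ e ∈ T, ¬ Cross d e) : d ∈ T := by
  classical
  by_contra hdT
  have := card_le_of_isDiagonal (F := insert d T) hn
    (by
      intro e he
      rcases Finset.mem_insert.1 he with rfl | he
      · exact hd
      · exact hT.1 e he)
    (by
      intro x hx e he
      rcases Finset.mem_insert.1 hx with hx' | hx' <;>
        rcases Finset.mem_insert.1 he with he' | he'
      · rw [hx', he']; exact not_cross_self _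
      · rw [hx']; exact hc _ he'
      · rw [he']; exact fun h => hc _ hx' h.symm
      · exact hT.2.1 x hx' e he')
  rw [Finset.card_insert_of_notMem hdT, hT.2.2] at this
  omega

theorem isEdge_of_not_cross (hn : 3 ≤ n) (hT : IsTriangulation T) {a b : Fin n} (hab : a < b)
    (hc : ∀ e ∈ T, ¬ Cross (a, b) e) : IsEdge T a b := by
  by_cases h : IsDiagonal (a, b)
  · exact Or.inr (Or.inr (hT.mem_of_not_cross hn h hc))
  · unfold IsDiagonal at h
    unfold IsEdge
    simp only [Fin.lt_def] at *
    omega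

/-- Every edge that is not a short side is the long side of a triangle. -/
theorem exists_apex (hn : 3 ≤ n) (hT : IsTriangulation T) {a b : Fin n} (h : IsEdge T a b)
    (hab : a.val + 1 < b.val) : ∃ c, a < c ∧ c < b ∧ IsEdge T a c ∧ IsEdge T c b := by
  obtain ⟨k, h1, h2, h3, h4⟩ := exists_max_apex T (a, b) hab
  simp only at h1 h2 h3 h4
  refine ⟨k, h1, h2, h3.imp_right Or.inr, hT.isEdge_of_not_cross hn h2 ?_⟩
  -- A diagonal crossing `(k, b)` but neither `(a, b)` nor `(a, k)` starts at `a` and ends strictly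
  -- between `k` and `b`, against the maximality of `k`.
  intro e he hcr
  have c1 := h.not_cross (hT.2.1 e he)
  have c2 : (a, k) ∈ T → ¬ Cross (a, k) e := fun hk => hT.2.1 _ hk e he
  have c3 : a = e.1 → e.2 < b → e.2 ≤ k := by
    rintro rfl hb
    exact h4 _ hb he
  have h3' : a.val + 1 = k.val ∨ ¬ Cross (a, k) e := h3.imp_right c2
  clear h3 c2 h4
  unfold Cross at *
  simp only [Fin.lt_def, Fin.le_def, Fin.ext_iff] at *
  omega

/-- Every diagonal is a short side of a triangle. -/
theorem exists_parent (hn : 3 ≤ n) (hT : IsTriangulation T) {a b : Fin n} (h : (a, b) ∈ T) :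
    (∃ c, b < c ∧ IsEdge T b c ∧ IsEdge T a c) ∨ (∃ c, c < a ∧ IsEdge T c a ∧ IsEdge T c b) := by
  classical
  have hd := hT.1 _ h
  have hb := b.2
  let s : Finset (Fin n × Fin n) := Finset.univ.filter fun e => IsEdge T e.1 e.2 ∧
    e.1 ≤ a ∧ b ≤ e.2 ∧ e ≠ (a, b)
  have hs : s.Nonempty := by
    refine ⟨(⟨0, by omega⟩, ⟨n - 1, by omega⟩), ?_⟩
    simp only [s, Finset.mem_filter, Finset.mem_univ, true_and, ne_eq, Prod.mk.injEq, Fin.ext_iff,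
      Fin.le_def, IsEdge]
    have h2 := hd.2
    simp only at h2
    refine ⟨Or.inr (Or.inl (by omega)), by omega, by omega, by omega⟩
  -- Take a shortest edge properly enclosing `(a, b)`. Its apex cannot lie strictly between `a` and
  -- `b`, so one of its two lower sides still encloses `(a, b)`, and by minimality equals it.
  obtain ⟨⟨i, j⟩, hk, hmin⟩ := s.exists_min_image (fun e => e.2.val - e.1.val) hs
  simp only [s, Finset.mem_filter, Finset.mem_univ, true_and] at hk hmin
  obtain ⟨he, hia, hbj, hne⟩ := hk
  have h1 := hd.1
  simp only [Fin.le_def] at hia hbj h1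
  obtain ⟨m, him, hmj, e1, e2⟩ := hT.exists_apex hn he (by omega)
  have c1 := e1.not_cross (hT.2.1 _ h)
  have c2 := e2.not_cross (hT.2.1 _ h)
  have m1 := hmin (i, m)
  have m2 := hmin (m, j)
  simp only [ne_eq, Prod.mk.injEq, Fin.ext_iff, Fin.lt_def, Fin.le_def, Cross] at *
  by_cases hm : b.val ≤ m.val
  · have : i.val = a.val ∧ m.val = b.val := by
      by_contra hcon
      have := m1 ⟨e1, by omega, by omega, by omega⟩
      omega
    obtain rfl : i = a := Fin.ext this.1
    obtain rfl : m = b := Fin.ext this.2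
    exact Or.inl ⟨j, by omega, e2, he⟩
  · have : m.val = a.val ∧ j.val = b.val := by
      by_contra hcon
      have := m2 ⟨e2, by omega, by omega, by omega⟩
      omega
    obtain rfl : m = a := Fin.ext this.1
    obtain rfl : j = b := Fin.ext this.2
    exact Or.inr ⟨i, by omega, e1, he⟩

/-- Every diagonal is a diagonal of a quadrilateral of edges. -/
theorem exists_quadrilateral (hn : 3 ≤ n) (hT : IsTriangulation T) {x : Fin n × Fin n}
    (hx : x ∈ T) : ∃ a b c d : Fin n, a < b ∧ b < c ∧ c < d ∧ IsEdge T a b ∧ IsEdge T b c ∧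
      IsEdge T c d ∧ IsEdge T a d ∧ (x = (a, c) ∨ x = (b, d)) := by
  obtain ⟨i, j⟩ := x
  obtain ⟨k, hik, hkj, e1, e2⟩ := hT.exists_apex hn (Or.inr (Or.inr hx)) (hT.1 _ hx).1
  rcases hT.exists_parent hn hx with ⟨c, hc, h1, h2⟩ | ⟨c, hc, h1, h2⟩
  · exact ⟨i, k, j, c, hik, hkj, hc, e1, e2, h1, h2, Or.inl rfl⟩
  · exact ⟨c, i, k, j, hc, hik, hkj, h1, e1, e2, h2, Or.inr rfl⟩

/-- A diagonal can be exchanged in at most one way. -/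
theorem exchange_unique (hn : 3 ≤ n) (hT : IsTriangulation T) {x : Fin n × Fin n} (hx : x ∈ T) :
    ∃ y, ∀ z, IsDiagonal z → z ∉ T → (∀ e ∈ T.erase x, ¬ Cross z e) → z = y := by
  classical
  obtain ⟨a, b, c, d, hab, hbc, hcd, e1, e2, e3, e4, h⟩ := hT.exists_quadrilateral hn hx
  have hcr : ∀ z, IsDiagonal z → z ∉ T → (∀ e ∈ T.erase x, ¬ Cross z e) → Cross z x := by
    intro z hz hzT hze
    by_contra hcon
    refine hzT (hT.mem_of_not_cross hn hz fun e he => ?_)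
    by_cases hex : e = x
    · rw [hex]; exact hcon
    · exact hze e (Finset.mem_erase.2 ⟨hex, he⟩)
  have side : ∀ u v : Fin n, IsEdge T u v → (u, v) ≠ x → IsEdge (T.erase x) u v :=
    fun u v huv hne => huv.mono fun h => Finset.mem_erase.2 ⟨hne, h⟩
  have s1 := side a b e1 (by rcases h with rfl | rfl <;>
    simp only [ne_eq, Prod.mk.injEq, Fin.ext_iff, Fin.lt_def] at * <;> omega)
  have s2 := side b c e2 (by rcases h with rfl | rfl <;>
    simp only [ne_eq, Prod.mk.injEq, Fin.ext_iff, Fin.lt_def] at * <;> omega)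
  have s3 := side c d e3 (by rcases h with rfl | rfl <;>
    simp only [ne_eq, Prod.mk.injEq, Fin.ext_iff, Fin.lt_def] at * <;> omega)
  have s4 := side a d e4 (by rcases h with rfl | rfl <;>
    simp only [ne_eq, Prod.mk.injEq, Fin.ext_iff, Fin.lt_def] at * <;> omega)
  -- The new diagonal crosses `x` but none of the four sides, so it must be the other diagonal of
  -- the quadrilateral.
  rcases h with h | h
  · refine ⟨(b, d), fun z hz hzT hze => ?_⟩
    have c0 := hcr z hz hzT hze
    have c1 := s1.not_cross hze
    have c2 := s2.not_cross hze
    have c3 := s3.not_cross hze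
    have c4 := s4.not_cross hze
    rw [h] at c0
    clear hz hze hcr
    simp only [Cross, Prod.ext_iff, Fin.ext_iff, Fin.lt_def] at *
    omega
  · refine ⟨(a, c), fun z hz hzT hze => ?_⟩
    have c0 := hcr z hz hzT hze
    have c1 := s1.not_cross hze
    have c2 := s2.not_cross hze
    have c3 := s3.not_cross hze
    have c4 := s4.not_cross hze
    rw [h] at c0
    clear hz hze hcr
    simp only [Cross, Prod.ext_iff, Fin.ext_iff, Fin.lt_def] at *
    omega

end IsTriangulation

theorem card_sdiff_of_adj (hn : 4 ≤ n) {S T : Triangulation n}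
    (h : (associahedronGraph n).Adj S T) : (S.val \ T.val).card = 1 := by
  have h1 := Finset.card_sdiff_add_card_inter S.val T.val
  have h2 := S.2.2.2
  have h3 := h.2
  omega

/-- A neighbour is determined by the diagonal it removes, since the replacement is then forced by
`exchange_unique`. -/
theorem degree_le (hn : 4 ≤ n) (T : Triangulation n) :
    (associahedronGraph n).degree T ≤ n - 3 := by
  classical
  have : Nonempty (Fin n × Fin n) := ⟨(⟨0, by omega⟩, ⟨0, by omega⟩)⟩
  have h1 : ∀ S, (associahedronGraph n).Adj T S →
      ∃ x y, T.val \ S.val = {x} ∧ S.val \ T.val = {y} := by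
    intro S h
    obtain ⟨x, hx⟩ := Finset.card_eq_one.1 (card_sdiff_of_adj hn h)
    obtain ⟨y, hy⟩ := Finset.card_eq_one.1 (card_sdiff_of_adj hn h.symm)
    exact ⟨x, y, hx, hy⟩
  choose! x y hx hy using h1
  have hxT : ∀ S, (associahedronGraph n).Adj T S → x S ∈ T.val := fun S h => by
    have : x S ∈ T.val \ S.val := by rw [hx S h]; simp
    exact (Finset.mem_sdiff.1 this).1
  rw [← SimpleGraph.card_neighborFinset_eq_degree, ← T.2.2.2]
  refine Finset.card_le_card_of_injOn x (fun S hS => hxT S (by simpa using hS)) ?_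
  intro S hS S' hS' heq
  replace hS : (associahedronGraph n).Adj T S := by simpa using hS
  replace hS' : (associahedronGraph n).Adj T S' := by simpa using hS'
  obtain ⟨w, hw⟩ := T.2.exchange_unique (by omega) (hxT S hS)
  have hyw : ∀ R, (associahedronGraph n).Adj T R → x R = x S → y R = w := by
    intro R hR hRx
    have hyR : y R ∈ R.val \ T.val := by rw [hy R hR]; simp
    rw [Finset.mem_sdiff] at hyR
    refine hw _ (R.2.1 _ hyR.1) hyR.2 fun e he => R.2.2.1 _ hyR.1 e ?_
    rw [Finset.mem_erase] at he
    by_contra heR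
    have : e ∈ T.val \ R.val := Finset.mem_sdiff.2 ⟨he.2, heR⟩
    rw [hx R hR, hRx, Finset.mem_singleton] at this
    exact he.1 this
  have hrep : ∀ R, (associahedronGraph n).Adj T R → R.val = (T.val \ {x R}) ∪ {y R} := by
    intro R hR
    rw [← hx R hR, ← hy R hR]
    ext e; simp only [Finset.mem_union, Finset.mem_sdiff]; tauto
  apply Subtype.ext
  rw [hrep S hS, hrep S' hS', hyw S hS rfl, hyw S' hS' heq.symm, heq]

end Combinatorics

end Associahedron

/-! ### From 5-cycles to the smallest eigenvalue. -/

theorem five_cycle_sq_add_ge (x : Fin 5 → ℝ) :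
    (3 - Real.sqrt 5) / 2 * ∑ i, x i ^ 2 ≤ ∑ i, (x i + x (i + 1)) ^ 2 := by
  obtain ⟨φ, hφ⟩ : ∃ φ, φ = (1 + Real.sqrt 5) / 2 := ⟨_, rfl⟩
  have h5 : Real.sqrt 5 ^ 2 = 5 := Real.sq_sqrt (by norm_num)
  have hlt : Real.sqrt 5 < 5 := by nlinarith [Real.sqrt_nonneg 5]
  have hgt : 1 < Real.sqrt 5 := by nlinarith [Real.sqrt_nonneg 5]
  have e : (3 - Real.sqrt 5) / 2 = 2 - φ := by rw [hφ]; ring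
  have h2 : φ ^ 2 = φ + 1 := by rw [hφ]; linear_combination h5 / 4
  rw [e]
  simp only [Fin.sum_univ_five, Fin.isValue, show (0 : Fin 5) + 1 = 1 from rfl,
    show (1 : Fin 5) + 1 = 2 from rfl, show (2 : Fin 5) + 1 = 3 from rfl,
    show (3 : Fin 5) + 1 = 4 from rfl, show (4 : Fin 5) + 1 = 0 from rfl]
  generalize x 0 = a, x 1 = b, x 2 = c, x 3 = d, x 4 = f
  -- The difference of the two sides is exactly the sum of the squares in `p1` and `p2`. The
  -- circulant forms in `p2` vanish on the extremal eigenspace, of frequency 2, and their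
  -- coefficient is fitted to frequency 1; `p1` corrects the constant vector.
  have p1 : 0 ≤ (6 - 2 * φ) / 5 * (a + b + c + d + f) ^ 2 :=
    mul_nonneg (by linarith) (sq_nonneg _)
  have p2 : 0 ≤ (2 * φ - 1) / 5 * (((φ - 1) * a - c - d) ^ 2 + ((φ - 1) * b - d - f) ^ 2 +
      ((φ - 1) * c - f - a) ^ 2 + ((φ - 1) * d - a - b) ^ 2 + ((φ - 1) * f - b - c) ^ 2) :=
    mul_nonneg (by linarith) (by positivity)
  have h3 : φ ^ 3 = 2 * φ + 1 := by linear_combination (φ + 1) * h2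
  nlinarith [p1, p2, h2, h3]

/-- If every vertex has degree at most `r` and lies on at least `m` closed walks of length five
of a family, and each edge is used at most `k` times by the family, then the quadratic form of the
adjacency matrix is bounded from below. -/
theorem SimpleGraph.adjMatrix_form_ge_of_five_cycles {V P : Type*} [Fintype V] [DecidableEq V]
    [Fintype P] (G : SimpleGraph V) [DecidableRel G.Adj] (t : P → Fin 5 → V) {m k r : ℕ}
    (hadj : ∀ p i, G.Adj (t p i) (t p (i + 1)))
    (hm : ∀ S, m ≤ (Finset.univ.filter fun q : P × Fin 5 => t q.1 q.2 = S).card)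
    (hk : ∀ S T, G.Adj S T → (Finset.univ.filter fun q : P × Fin 5 =>
      (t q.1 q.2 = S ∧ t q.1 (q.2 + 1) = T) ∨ (t q.1 q.2 = T ∧ t q.1 (q.2 + 1) = S)).card ≤ k)
    (hr : ∀ S, G.degree S ≤ r) (f : V → ℝ) :
    (3 - Real.sqrt 5) / 2 * m * ∑ S, f S ^ 2 ≤
      k * (r * ∑ S, f S ^ 2 + ∑ S, ∑ T, if G.Adj S T then f S * f T else 0) := by
  have hpos : (0 : ℝ) ≤ (3 - Real.sqrt 5) / 2 := by
    have h5 : Real.sqrt 5 ^ 2 = 5 := Real.sq_sqrt (by norm_num)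
    nlinarith [Real.sqrt_nonneg 5]
  let g : V → V → ℝ := fun S T => (f S + f T) ^ 2
  have hg : ∀ S T, g S T = g T S := fun S T => by simp only [g]; ring
  have a1 : (m : ℝ) * ∑ S, f S ^ 2 ≤ ∑ p, ∑ i, f (t p i) ^ 2 := by
    rw [← Fintype.sum_prod_type' (f := fun p i => f (t p i) ^ 2),
      ← Finset.sum_fiberwise (s := Finset.univ) (g := fun q : P × Fin 5 => t q.1 q.2),
      Finset.mul_sum]
    refine Finset.sum_le_sum fun S _ => ?_
    rw [Finset.sum_congr rfl (g := fun _ => f S ^ 2)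
      (fun q hq => by rw [(Finset.mem_filter.1 hq).2]), Finset.sum_const, nsmul_eq_mul]
    exact mul_le_mul_of_nonneg_right (by exact_mod_cast hm S) (sq_nonneg _)
  have a2 : (3 - Real.sqrt 5) / 2 * ∑ p, ∑ i, f (t p i) ^ 2 ≤
      ∑ p, ∑ i, g (t p i) (t p (i + 1)) := by
    rw [Finset.mul_sum]
    exact Finset.sum_le_sum fun p _ => five_cycle_sq_add_ge fun i => f (t p i)
  -- The right side runs over ordered pairs, so each cycle edge is counted in both orientations,
  -- whence the factor 2.
  have a3 : 2 * ∑ p, ∑ i, g (t p i) (t p (i + 1)) ≤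
      k * ∑ S, ∑ T, if G.Adj S T then g S T else 0 := by
    rw [← Fintype.sum_prod_type' (f := fun p i => g (t p i) (t p (i + 1)))]
    have e1 : ∑ q : P × Fin 5, g (t q.1 q.2) (t q.1 (q.2 + 1)) =
        ∑ S, ∑ T, ∑ q : P × Fin 5, if t q.1 q.2 = S ∧ t q.1 (q.2 + 1) = T then g S T else 0 := by
      rw [Finset.sum_congr rfl fun S _ => Finset.sum_comm, Finset.sum_comm]
      refine Finset.sum_congr rfl fun q _ => ?_
      simp only [ite_and, Finset.sum_ite_irrel, Finset.sum_ite_eq, Finset.mem_univ, if_true,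
        Finset.sum_const_zero]
    have e2 : ∑ q : P × Fin 5, g (t q.1 q.2) (t q.1 (q.2 + 1)) =
        ∑ S, ∑ T, ∑ q : P × Fin 5, if t q.1 q.2 = T ∧ t q.1 (q.2 + 1) = S then g S T else 0 := by
      rw [e1, Finset.sum_comm]
      simp only [hg]
    rw [two_mul]
    nth_rewrite 1 [e1]
    rw [e2]
    simp only [Finset.mul_sum, ← Finset.sum_add_distrib]
    refine Finset.sum_le_sum fun S _ => Finset.sum_le_sum fun T _ => ?_
    split_ifs with hST
    · have e3 : ∀ q : P × Fin 5, ((if t q.1 q.2 = S ∧ t q.1 (q.2 + 1) = T then g S T else 0) +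
          (if t q.1 q.2 = T ∧ t q.1 (q.2 + 1) = S then g S T else 0)) =
          if (t q.1 q.2 = S ∧ t q.1 (q.2 + 1) = T) ∨ (t q.1 q.2 = T ∧ t q.1 (q.2 + 1) = S)
          then g S T else 0 := by
        intro q
        have hne := hST.ne
        by_cases h1 : t q.1 q.2 = S ∧ t q.1 (q.2 + 1) = T
        · have h2 : ¬ (t q.1 q.2 = T ∧ t q.1 (q.2 + 1) = S) := fun h => hne (h1.1.symm.trans h.1)
          rw [if_pos h1, if_neg h2, if_pos (Or.inl h1), add_zero]
        · simp [h1]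
      rw [Finset.sum_congr rfl fun q _ => e3 q, ← Finset.sum_filter, Finset.sum_const,
        nsmul_eq_mul]
      exact mul_le_mul_of_nonneg_right (by exact_mod_cast hk S T hST) (sq_nonneg _)
    · refine le_of_eq ?_
      rw [mul_zero]
      refine Finset.sum_eq_zero fun q _ => ?_
      have := hadj q.1 q.2
      rw [if_neg, if_neg, add_zero]
      · rintro ⟨h1, h2⟩; rw [h1, h2] at this; exact hST this.symm
      · rintro ⟨h1, h2⟩; rw [h1, h2] at this; exact hST this
  have a4 : (∑ S, ∑ T, if G.Adj S T then g S T else 0) ≤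
      2 * (r * ∑ S, f S ^ 2) + 2 * ∑ S, ∑ T, if G.Adj S T then f S * f T else 0 := by
    have b1 : (∑ S, ∑ T, if G.Adj S T then f S ^ 2 else 0) ≤ r * ∑ S, f S ^ 2 := by
      rw [Finset.mul_sum]
      refine Finset.sum_le_sum fun S _ => ?_
      rw [← Finset.sum_filter, Finset.sum_const, nsmul_eq_mul, ← G.neighborFinset_eq_filter,
        G.card_neighborFinset_eq_degree]
      exact mul_le_mul_of_nonneg_right (by exact_mod_cast hr S) (sq_nonneg _)
    have b2 : (∑ S, ∑ T, if G.Adj S T then f T ^ 2 else 0) =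
        ∑ S, ∑ T, if G.Adj S T then f S ^ 2 else 0 := by
      rw [Finset.sum_comm]
      exact Finset.sum_congr rfl fun S _ => Finset.sum_congr rfl fun T _ =>
        if_congr (G.adj_comm T S) rfl rfl
    have b3 : (∑ S, ∑ T, if G.Adj S T then g S T else 0) =
        (∑ S, ∑ T, if G.Adj S T then f S ^ 2 else 0) +
        (∑ S, ∑ T, if G.Adj S T then f T ^ 2 else 0) +
        2 * ∑ S, ∑ T, if G.Adj S T then f S * f T else 0 := by
      simp only [Finset.mul_sum, ← Finset.sum_add_distrib]
      refine Finset.sum_congr rfl fun S _ => Finset.sum_congr rfl fun T _ => ?_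
      simp only [g]
      split_ifs <;> ring
    linarith
  have a5 := mul_le_mul_of_nonneg_left a1 hpos
  have a6 := mul_le_mul_of_nonneg_left a4 (Nat.cast_nonneg (α := ℝ) k)
  nlinarith

/-- A lower bound for the quadratic form of the adjacency matrix bounds the smallest eigenvalue. -/
theorem Associahedron.exists_isSmallestEigenvalue_ge {V : Type*} [Fintype V] [DecidableEq V]
    [Nonempty V] (G : SimpleGraph V) [DecidableRel G.Adj] {c : ℝ}
    (h : ∀ f : V → ℝ, c * ∑ S, f S ^ 2 ≤ ∑ S, ∑ T, if G.Adj S T then f S * f T else 0) :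
    ∃ μ, IsSmallestEigenvalue G μ ∧ c ≤ μ := by
  have hA : (G.adjMatrix ℝ).IsHermitian := by
    rw [Matrix.IsHermitian, Matrix.conjTranspose_eq_transpose_of_trivial]
    exact G.isSymm_adjMatrix
  let s : Set ℝ := {x : ℝ | Module.End.HasEigenvalue (Matrix.toLin' (G.adjMatrix ℝ)) x}
  have hfin : s.Finite := Module.End.finite_hasEigenvalue _
  have hne : s.Nonempty := by
    obtain ⟨i⟩ := ‹Nonempty V›
    refine ⟨hA.eigenvalues i, ?_⟩
    have hv := hA.mulVec_eigenvectorBasis i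
    refine Module.End.hasEigenvalue_of_hasEigenvector
      (x := (hA.eigenvectorBasis i).ofLp) ⟨?_, ?_⟩
    · rw [Module.End.mem_eigenspace_iff, Matrix.toLin'_apply]
      exact hv
    · intro h0
      exact hA.eigenvectorBasis.orthonormal.ne_zero i (by ext j; exact congrFun h0 j)
  -- The spectrum is finite, and nonempty by the spectral theorem, so it has a least element.
  obtain ⟨μ, hμ, hmin⟩ := hfin.exists_minimal hne
  refine ⟨μ, ⟨hμ, fun y hy => ?_⟩, ?_⟩
  · rcases le_total μ y with h1 | h1
    · exact h1
    · exact hmin hy h1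
  · obtain ⟨f, hf⟩ := Module.End.HasEigenvalue.exists_hasEigenvector hμ
    have h1 : Matrix.mulVec (G.adjMatrix ℝ) f = μ • f := by
      simpa using hf.apply_eq_smul
    have h2 : (∑ S, ∑ T, if G.Adj S T then f S * f T else 0) = μ * ∑ S, f S ^ 2 := by
      rw [Finset.mul_sum]
      refine Finset.sum_congr rfl fun S _ => ?_
      have h3 := congrFun h1 S
      simp only [Matrix.mulVec, dotProduct, SimpleGraph.adjMatrix_apply, Pi.smul_apply,
        smul_eq_mul] at h3
      calc _ = f S * ∑ T, (if G.Adj S T then (1 : ℝ) else 0) * f T := by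
            rw [Finset.mul_sum]
            refine Finset.sum_congr rfl fun T _ => ?_
            split_ifs <;> ring
        _ = _ := by rw [h3]; ring
    have h3 := h f
    rw [h2] at h3
    have hpos : 0 < ∑ S, f S ^ 2 := by
      obtain ⟨S, hS⟩ := Function.ne_iff.1 hf.2
      exact Finset.sum_pos' (fun _ _ => sq_nonneg _)
        ⟨S, Finset.mem_univ _, lt_of_le_of_ne (sq_nonneg _) (Ne.symm (pow_ne_zero 2 hS))⟩
    exact le_of_mul_le_mul_right h3 hpos

namespace Associahedron

/-! ### Pentagonal faces as 5-cycles of flips. -/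

section Pentagons

variable {n : ℕ}

/-- The diagonals of the pentagon with vertices `v`, ordered so that exactly the consecutive ones
do not cross. -/
def pentagonDiagonal (v : Fin 5 → Fin n) : Fin 5 → Fin n × Fin n :=
  ![(v 0, v 2), (v 2, v 4), (v 1, v 4), (v 1, v 3), (v 0, v 3)]

/-- The sides of the pentagon with vertices `v`. -/
def pentagonSide (v : Fin 5 → Fin n) : Fin 5 → Fin n × Fin n :=
  ![(v 0, v 1), (v 1, v 2), (v 2, v 3), (v 3, v 4), (v 0, v 4)]

/-- A set of `n - 5` non-crossing diagonals which leaves exactly one pentagon untriangulated. -/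
structure IsPentagon (v : Fin 5 → Fin n) (W : Finset (Fin n × Fin n)) : Prop where
  strictMono : StrictMono v
  isDiagonal : ∀ d ∈ W, IsDiagonal d
  not_cross : ∀ d ∈ W, ∀ e ∈ W, ¬ Cross d e
  card : W.card + 5 = n
  edge₀ : IsEdge W (v 0) (v 1)
  edge₁ : IsEdge W (v 1) (v 2)
  edge₂ : IsEdge W (v 2) (v 3)
  edge₃ : IsEdge W (v 3) (v 4)
  edge₄ : IsEdge W (v 0) (v 4)
  notMem : ∀ i, pentagonDiagonal v i ∉ W

theorem StrictMono.pentagon {v : Fin 5 → Fin n} (h : StrictMono v) :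
    (v 0).val < (v 1).val ∧ (v 1).val < (v 2).val ∧ (v 2).val < (v 3).val ∧
      (v 3).val < (v 4).val :=
  ⟨h (by decide), h (by decide), h (by decide), h (by decide)⟩

theorem pentagonDiagonal_cases (v : Fin 5 → Fin n) (i : Fin 5) :
    (i.val = 0 ∧ pentagonDiagonal v i = (v 0, v 2) ∧ pentagonDiagonal v (i + 1) = (v 2, v 4) ∧
      pentagonDiagonal v (i + 2) = (v 1, v 4)) ∨
    (i.val = 1 ∧ pentagonDiagonal v i = (v 2, v 4) ∧ pentagonDiagonal v (i + 1) = (v 1, v 4) ∧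
      pentagonDiagonal v (i + 2) = (v 1, v 3)) ∨
    (i.val = 2 ∧ pentagonDiagonal v i = (v 1, v 4) ∧ pentagonDiagonal v (i + 1) = (v 1, v 3) ∧
      pentagonDiagonal v (i + 2) = (v 0, v 3)) ∨
    (i.val = 3 ∧ pentagonDiagonal v i = (v 1, v 3) ∧ pentagonDiagonal v (i + 1) = (v 0, v 3) ∧
      pentagonDiagonal v (i + 2) = (v 0, v 2)) ∨
    (i.val = 4 ∧ pentagonDiagonal v i = (v 0, v 3) ∧ pentagonDiagonal v (i + 1) = (v 0, v 2) ∧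
      pentagonDiagonal v (i + 2) = (v 2, v 4)) := by
  match i with
  | 0 => exact Or.inl ⟨rfl, rfl, rfl, rfl⟩
  | 1 => exact Or.inr (Or.inl ⟨rfl, rfl, rfl, rfl⟩)
  | 2 => exact Or.inr (Or.inr (Or.inl ⟨rfl, rfl, rfl, rfl⟩))
  | 3 => exact Or.inr (Or.inr (Or.inr (Or.inl ⟨rfl, rfl, rfl, rfl⟩)))
  | 4 => exact Or.inr (Or.inr (Or.inr (Or.inr ⟨rfl, rfl, rfl, rfl⟩)))

theorem isDiagonal_pentagonDiagonal {v : Fin 5 → Fin n} (h : StrictMono v) (i : Fin 5) :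
    IsDiagonal (pentagonDiagonal v i) := by
  have := StrictMono.pentagon h
  have h4 := (v 4).2
  rcases pentagonDiagonal_cases v i with
      ⟨hi, hi0, hi1, hi2⟩ | ⟨hi, hi0, hi1, hi2⟩ | ⟨hi, hi0, hi1, hi2⟩ |
      ⟨hi, hi0, hi1, hi2⟩ | ⟨hi, hi0, hi1, hi2⟩ <;>
    rw [hi0] <;> simp only [IsDiagonal] <;> omega

theorem pentagonDiagonal_injective {v : Fin 5 → Fin n} (h : StrictMono v) :
    Function.Injective (pentagonDiagonal v) := by
  have := StrictMono.pentagon h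
  intro i j
  rcases pentagonDiagonal_cases v i with
      ⟨hi, hi0, hi1, hi2⟩ | ⟨hi, hi0, hi1, hi2⟩ | ⟨hi, hi0, hi1, hi2⟩ |
      ⟨hi, hi0, hi1, hi2⟩ | ⟨hi, hi0, hi1, hi2⟩ <;>
    rcases pentagonDiagonal_cases v j with
        ⟨hj, hj0, hj1, hj2⟩ | ⟨hj, hj0, hj1, hj2⟩ | ⟨hj, hj0, hj1, hj2⟩ |
        ⟨hj, hj0, hj1, hj2⟩ | ⟨hj, hj0, hj1, hj2⟩ <;>
    rw [hi0, hj0] <;> simp only [Prod.mk.injEq, Fin.ext_iff] <;> omega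

theorem not_cross_pentagonDiagonal_succ {v : Fin 5 → Fin n} (h : StrictMono v) (i : Fin 5) :
    ¬ Cross (pentagonDiagonal v i) (pentagonDiagonal v (i + 1)) := by
  have := StrictMono.pentagon h
  rcases pentagonDiagonal_cases v i with
      ⟨hi, hi0, hi1, hi2⟩ | ⟨hi, hi0, hi1, hi2⟩ | ⟨hi, hi0, hi1, hi2⟩ |
      ⟨hi, hi0, hi1, hi2⟩ | ⟨hi, hi0, hi1, hi2⟩ <;>
    rw [hi0, hi1] <;> simp only [Cross, Fin.lt_def] <;> omega

namespace IsPentagon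

variable {v : Fin 5 → Fin n} {W : Finset (Fin n × Fin n)}

-- A chord crossing no side of the pentagon either avoids its interior or is one of its diagonals,
-- and `notMem` excludes the latter.
set_option maxHeartbeats 2000000 in
theorem not_cross_diagonal (h : IsPentagon v W) {z : Fin n × Fin n} (hz : z ∈ W) (i : Fin 5) :
    ¬ Cross z (pentagonDiagonal v i) := by
  have hv := StrictMono.pentagon h.strictMono
  have hc := h.not_cross z hz
  have c0 := h.edge₀.not_cross hc
  have c1 := h.edge₁.not_cross hc
  have c2 := h.edge₂.not_cross hc
  have c3 := h.edge₃.not_cross hc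
  have c4 := h.edge₄.not_cross hc
  have hne : ∀ j, z ≠ pentagonDiagonal v j := fun j hj => h.notMem j (hj ▸ hz)
  have n0 : z ≠ (v 0, v 2) := hne 0
  have n1 : z ≠ (v 2, v 4) := hne 1
  have n2 : z ≠ (v 1, v 4) := hne 2
  have n3 : z ≠ (v 1, v 3) := hne 3
  have n4 : z ≠ (v 0, v 3) := hne 4
  clear hne hc h
  rcases pentagonDiagonal_cases v i with
      ⟨hi, hi0, hi1, hi2⟩ | ⟨hi, hi0, hi1, hi2⟩ | ⟨hi, hi0, hi1, hi2⟩ |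
      ⟨hi, hi0, hi1, hi2⟩ | ⟨hi, hi0, hi1, hi2⟩ <;>
    rw [hi0] <;> clear hi0 hi1 hi2 <;>
    simp only [ne_eq, Prod.ext_iff, Fin.ext_iff, Cross, Fin.lt_def] at * <;> omega

theorem not_cross_side (h : IsPentagon v W) {z : Fin n × Fin n} (hz : ∀ e ∈ W, ¬ Cross z e)
    (i : Fin 5) : ¬ Cross z (pentagonSide v i) :=
  match i with
  | 0 => h.edge₀.not_cross hz
  | 1 => h.edge₁.not_cross hz
  | 2 => h.edge₂.not_cross hz
  | 3 => h.edge₃.not_cross hz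
  | 4 => h.edge₄.not_cross hz

theorem isTriangulation (h : IsPentagon v W) (i : Fin 5) : IsTriangulation
    (insert (pentagonDiagonal v i) (insert (pentagonDiagonal v (i + 1)) W)) := by
  have hne : pentagonDiagonal v i ≠ pentagonDiagonal v (i + 1) := fun he => by
    exact (by decide : ∀ i : Fin 5, i ≠ i + 1) i (pentagonDiagonal_injective h.strictMono he)
  have hc := not_cross_pentagonDiagonal_succ h.strictMono i
  refine ⟨?_, ?_, ?_⟩
  · intro d hd
    simp only [Finset.mem_insert] at hd
    rcases hd with rfl | rfl | hd
    · exact isDiagonal_pentagonDiagonal h.strictMono _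
    · exact isDiagonal_pentagonDiagonal h.strictMono _
    · exact h.isDiagonal d hd
  · intro d hd e he
    simp only [Finset.mem_insert] at hd he
    rcases hd with hd | hd | hd <;> rcases he with he | he | he
    · rw [hd, he]; exact not_cross_self _
    · rw [hd, he]; exact hc
    · rw [hd]; exact fun hx => h.not_cross_diagonal he _ hx.symm
    · rw [hd, he]; exact fun hx => hc hx.symm
    · rw [hd, he]; exact not_cross_self _
    · rw [hd]; exact fun hx => h.not_cross_diagonal he _ hx.symm
    · rw [he]; exact h.not_cross_diagonal hd _
    · rw [he]; exact h.not_cross_diagonal hd _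
    · exact h.not_cross d hd e he
  · have := h.card
    rw [Finset.card_insert_of_notMem, Finset.card_insert_of_notMem (h.notMem _)]
    · omega
    · simp only [Finset.mem_insert, not_or]
      exact ⟨hne, h.notMem _⟩

end IsPentagon

variable (n) in
/-- The pentagonal faces of the associahedron. -/
abbrev Pentagon : Type :=
  {p : (Fin 5 → Fin n) × Finset (Fin n × Fin n) // IsPentagon p.1 p.2}

noncomputable instance : Fintype (Pentagon n) := Fintype.ofFinite _

/-- The five triangulations around a pentagonal face. -/
def Pentagon.vertex (p : Pentagon n) (i : Fin 5) : Triangulation n :=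
  ⟨_, p.2.isTriangulation i⟩

/-- The diagonals of the pentagon of a pentagonal face. -/
abbrev Pentagon.diagonal (p : Pentagon n) : Fin 5 → Fin n × Fin n := pentagonDiagonal p.1.1

theorem Pentagon.vertex_sdiff (p : Pentagon n) (i : Fin 5) :
    (p.vertex i).val \ (p.vertex (i + 1)).val = {p.diagonal i} := by
  have hinj := pentagonDiagonal_injective p.2.strictMono
  have h1 : pentagonDiagonal p.1.1 i ≠ pentagonDiagonal p.1.1 (i + 1) := fun he => by
    exact (by decide : ∀ i : Fin 5, i ≠ i + 1) i (hinj he)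
  have h2 : pentagonDiagonal p.1.1 i ≠ pentagonDiagonal p.1.1 (i + 1 + 1) := fun he => by
    exact (by decide : ∀ i : Fin 5, i ≠ i + 1 + 1) i (hinj he)
  have h3 := p.2.notMem i
  ext d
  simp only [vertex, Finset.mem_sdiff, Finset.mem_insert, Finset.mem_singleton, not_or]
  constructor
  · tauto
  · rintro rfl; tauto

theorem Pentagon.vertex_succ_sdiff (p : Pentagon n) (i : Fin 5) :
    (p.vertex (i + 1)).val \ (p.vertex i).val = {p.diagonal (i + 2)} := by
  have hinj := pentagonDiagonal_injective p.2.strictMono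
  have h1 : pentagonDiagonal p.1.1 (i + 2) ≠ pentagonDiagonal p.1.1 (i + 1) := fun he => by
    exact (by decide : ∀ i : Fin 5, i + 2 ≠ i + 1) i (hinj he)
  have h2 : pentagonDiagonal p.1.1 (i + 2) ≠ pentagonDiagonal p.1.1 i := fun he => by
    exact (by decide : ∀ i : Fin 5, i + 2 ≠ i) i (hinj he)
  have h3 := p.2.notMem (i + 2)
  have h4 : i + 1 + 1 = i + 2 := (by decide : ∀ i : Fin 5, i + 1 + 1 = i + 2) i
  ext d
  simp only [vertex, Finset.mem_sdiff, Finset.mem_insert, Finset.mem_singleton, not_or, h4]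
  constructor
  · tauto
  · rintro rfl; tauto

theorem Pentagon.vertex_sdiff_snd (p : Pentagon n) (i : Fin 5) :
    (p.vertex i).val \ p.1.2 = {p.diagonal i, p.diagonal (i + 1)} := by
  have h1 := p.2.notMem i
  have h2 := p.2.notMem (i + 1)
  ext d
  simp only [vertex, Finset.mem_sdiff, Finset.mem_insert, Finset.mem_singleton]
  constructor
  · tauto
  · rintro (rfl | rfl) <;> tauto

theorem Pentagon.adj (p : Pentagon n) (i : Fin 5) :
    (associahedronGraph n).Adj (p.vertex i) (p.vertex (i + 1)) := by
  have h1 := p.vertex_sdiff i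
  have h2 := Finset.card_sdiff_add_card_inter (p.vertex i).val (p.vertex (i + 1)).val
  rw [h1, (p.vertex i).2.2.2, Finset.card_singleton] at h2
  refine ⟨fun he => ?_, by omega⟩
  rw [← he, Finset.sdiff_self] at h1
  exact (Finset.singleton_ne_empty _ h1.symm).elim

/-! ### Counting the faces through a triangulation. -/

/-- A triangulation containing the sides of a pentagon and two of its diagonals lies on a
pentagonal face. -/
theorem exists_pentagon (hn : 5 ≤ n) (T : Triangulation n) (v : Fin 5 → Fin n)
    (hv : StrictMono v) (e₀ : IsEdge T.val (v 0) (v 1)) (e₁ : IsEdge T.val (v 1) (v 2))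
    (e₂ : IsEdge T.val (v 2) (v 3)) (e₃ : IsEdge T.val (v 3) (v 4))
    (e₄ : IsEdge T.val (v 0) (v 4)) (i : Fin 5) (h₁ : pentagonDiagonal v i ∈ T.val)
    (h₂ : pentagonDiagonal v (i + 1) ∈ T.val) :
    ∃ q : Pentagon n × Fin 5, q.1.vertex q.2 = T ∧
      T.val \ q.1.1.2 = {pentagonDiagonal v i, pentagonDiagonal v (i + 1)} := by
  have hne : pentagonDiagonal v i ≠ pentagonDiagonal v (i + 1) := fun he => by
    exact (by decide : ∀ i : Fin 5, i ≠ i + 1) i (pentagonDiagonal_injective hv he)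
  have hlt := StrictMono.pentagon hv
  let W := (T.val.erase (pentagonDiagonal v i)).erase (pentagonDiagonal v (i + 1))
  have side : ∀ a b, (∀ j, pentagonDiagonal v j ≠ (a, b)) → IsEdge T.val a b → IsEdge W a b :=
    fun a b hj h => h.mono fun hm => Finset.mem_erase.2
      ⟨(hj _).symm, Finset.mem_erase.2 ⟨(hj _).symm, hm⟩⟩
  have hside : ∀ a b : Fin 5, (a.val + 1 = b.val ∨ a.val = 0 ∧ b.val = 4) →
      ∀ j, pentagonDiagonal v j ≠ (v a, v b) := by
    intro a b hab j h
    have h1 := fun a b : Fin 5 => hv.injective (a₁ := a) (a₂ := b)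
    rcases pentagonDiagonal_cases v j with
        ⟨hj, hj0, hj1, hj2⟩ | ⟨hj, hj0, hj1, hj2⟩ | ⟨hj, hj0, hj1, hj2⟩ |
        ⟨hj, hj0, hj1, hj2⟩ | ⟨hj, hj0, hj1, hj2⟩ <;>
      rw [hj0, Prod.mk.injEq] at h <;> have h2 := h1 _ _ h.1 <;> have h3 := h1 _ _ h.2 <;>
      subst h2 <;> subst h3 <;> simp at hab
  have hp : IsPentagon v W :=
    { strictMono := hv
      isDiagonal := fun d hd => T.2.1 d (Finset.mem_of_mem_erase (Finset.mem_of_mem_erase hd))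
      not_cross := fun d hd e he => T.2.2.1 d (Finset.mem_of_mem_erase (Finset.mem_of_mem_erase hd))
        e (Finset.mem_of_mem_erase (Finset.mem_of_mem_erase he))
      card := by
        simp only [W]
        rw [Finset.card_erase_of_mem (Finset.mem_erase.2 ⟨hne.symm, h₂⟩),
          Finset.card_erase_of_mem h₁, T.2.2.2]
        omega
      edge₀ := side _ _ (hside _ _ (by decide)) e₀
      edge₁ := side _ _ (hside _ _ (by decide)) e₁
      edge₂ := side _ _ (hside _ _ (by decide)) e₂
      edge₃ := side _ _ (hside _ _ (by decide)) e₃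
      edge₄ := side _ _ (hside _ _ (by decide)) e₄
      -- Any diagonal of the pentagon other than numbers `i` and `i + 1` crosses one of these two,
      -- so it is not in `T`.
      notMem := fun j hj => by
        have j1 : j ≠ i + 1 := fun h => (Finset.mem_erase.1 hj).1 (by rw [h])
        have j2 : j ≠ i := fun h =>
          (Finset.mem_erase.1 (Finset.mem_of_mem_erase hj)).1 (by rw [h])
        have hjT := Finset.mem_of_mem_erase (Finset.mem_of_mem_erase hj)
        have c1 := T.2.2.1 _ hjT _ h₁
        have c2 := T.2.2.1 _ hjT _ h₂
        have j3 : j.val ≠ i.val := fun h => j2 (Fin.ext h)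
        have j4 : j.val ≠ (i.val + 1) % 5 := fun h => j1 (Fin.ext (by rw [h, Fin.val_add]; rfl))
        clear side hj hjT hne h₁ h₂ hside
        rcases pentagonDiagonal_cases v i with
            ⟨hi, hi0, hi1, hi2⟩ | ⟨hi, hi0, hi1, hi2⟩ | ⟨hi, hi0, hi1, hi2⟩ |
            ⟨hi, hi0, hi1, hi2⟩ | ⟨hi, hi0, hi1, hi2⟩ <;>
          rcases pentagonDiagonal_cases v j with
              ⟨hj, hj0, hj1, hj2⟩ | ⟨hj, hj0, hj1, hj2⟩ | ⟨hj, hj0, hj1, hj2⟩ |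
              ⟨hj, hj0, hj1, hj2⟩ | ⟨hj, hj0, hj1, hj2⟩ <;>
          rw [hj0, hi0] at c1 <;> rw [hj0, hi1] at c2 <;>
          clear hi0 hi1 hi2 hj0 hj1 hj2 <;> simp only [Cross, Fin.lt_def] at c1 c2 <;> omega }
  have hvert : Pentagon.vertex ⟨(v, W), hp⟩ i = T := by
    apply Subtype.ext
    simp only [Pentagon.vertex, W]
    rw [Finset.insert_erase (Finset.mem_erase.2 ⟨hne.symm, h₂⟩), Finset.insert_erase h₁]
  refine ⟨(⟨(v, W), hp⟩, i), hvert, ?_⟩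
  have := Pentagon.vertex_sdiff_snd ⟨(v, W), hp⟩ i
  rw [hvert] at this
  exact this

/-- The same as `exists_pentagon`, with explicit vertices. -/
theorem exists_pentagon' (hn : 5 ≤ n) (T : Triangulation n) {a b c d e : Fin n}
    (hab : a < b) (hbc : b < c) (hcd : c < d) (hde : d < e)
    (e₀ : IsEdge T.val a b) (e₁ : IsEdge T.val b c) (e₂ : IsEdge T.val c d)
    (e₃ : IsEdge T.val d e) (e₄ : IsEdge T.val a e) (i : Fin 5) {x y : Fin n × Fin n}
    (hx : x ∈ T.val) (hy : y ∈ T.val)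
    (h : (pentagonDiagonal ![a, b, c, d, e] i = x ∧
        pentagonDiagonal ![a, b, c, d, e] (i + 1) = y) ∨
      (pentagonDiagonal ![a, b, c, d, e] i = y ∧
        pentagonDiagonal ![a, b, c, d, e] (i + 1) = x)) :
    ∃ q : Pentagon n × Fin 5, q.1.vertex q.2 = T ∧ T.val \ q.1.1.2 = {x, y} := by
  have hv : StrictMono ![a, b, c, d, e] := by
    rw [Fin.strictMono_iff_lt_succ]
    intro j
    fin_cases j
    · exact hab
    · exact hbc
    · exact hcd
    · exact hde
  rcases h with ⟨rfl, rfl⟩ | ⟨rfl, rfl⟩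
  · exact exists_pentagon hn T _ hv e₀ e₁ e₂ e₃ e₄ i hx hy
  · rw [Finset.pair_comm]
    exact exists_pentagon hn T _ hv e₀ e₁ e₂ e₃ e₄ i hy hx

/-- All diagonals of a triangulation but one can be paired with a diagonal of the same triangle
in such a way that the pairs are distinct. -/
theorem exists_pentagon_of_mem (hn : 5 ≤ n) (T : Triangulation n) :
    ∃ x₀ ∈ T.val, ∀ x ∈ T.val, x ≠ x₀ → ∃ q : Pentagon n × Fin 5, q.1.vertex q.2 = T ∧
      ∃ y, T.val \ q.1.1.2 = {x, y} ∧ (y = x₀ ∨ x.2.val - x.1.val < y.2.val - y.1.val) := by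
  have hn3 : 3 ≤ n := by omega
  obtain ⟨o, ho⟩ : ∃ o : Fin n, o.val = 0 := ⟨⟨0, by omega⟩, rfl⟩
  obtain ⟨l, hl⟩ : ∃ l : Fin n, l.val + 1 = n := ⟨⟨n - 1, by omega⟩, by simp; omega⟩
  have hroot : IsEdge T.val o l := Or.inr (Or.inl ⟨ho, hl⟩)
  obtain ⟨k, hok, hkl, r1, r2⟩ := T.2.exists_apex hn3 hroot (by omega)
  have hok' := Fin.lt_def.1 hok
  have hkl' := Fin.lt_def.1 hkl
  -- the diagonals not cut off by the root triangle
  have main : ∀ x ∈ T.val, x ≠ (o, k) → x ≠ (k, l) → ∃ q : Pentagon n × Fin 5,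
      q.1.vertex q.2 = T ∧ ∃ y, T.val \ q.1.1.2 = {x, y} ∧
        x.2.val - x.1.val < y.2.val - y.1.val := by
    rintro ⟨i, j⟩ hx h1 h2
    obtain ⟨t, hit, htj, s1, s2⟩ := T.2.exists_apex hn3 (Or.inr (Or.inr hx)) (T.2.1 _ hx).1
    have cr1 := r1.not_cross (T.2.2.1 _ hx)
    have cr2 := r2.not_cross (T.2.2.1 _ hx)
    have hd := T.2.1 _ hx
    rcases T.2.exists_parent hn3 hx with ⟨c, hc, p1, p2⟩ | ⟨c, hc, p1, p2⟩
    · have hy : (i, c) ∈ T.val := by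
        refine p2.mem ⟨?_, ?_⟩
        · simp only [Fin.lt_def] at *; omega
        -- If `(i, c)` were the root side, the noncrossing triangles `i j c` and `o k l` on it would
        -- coincide, forcing `x = (o, k)`.
        · rintro ⟨c1, c2⟩
          have cr3 : IsEdge T.val j c := p1
          have cr4 := cr3.not_cross (z := (o, k))
          have cr5 : (o, k) ∈ T.val → ¬ Cross (o, k) (j, c) := fun h => cr4 (T.2.2.1 _ h)
          have cr6 : (k, l) ∈ T.val → ¬ Cross (i, j) (k, l) := fun h => T.2.2.1 _ hx _ h
          have r1' : o.val + 1 = k.val ∨ (o, k) ∈ T.val := by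
            rcases r1 with h | h | h
            · exact Or.inl h
            · omega
            · exact Or.inr h
          have r1'' := r1'.imp_right cr5
          clear r1 r2 r1' cr4 cr5 cr3 p1 p2 s1 s2 hroot hx
          simp only [ne_eq, Prod.mk.injEq, Fin.ext_iff, Cross, Fin.lt_def, IsDiagonal] at *
          omega
      rcases T.2.exists_parent hn3 hy with ⟨f, hf, q1, q2⟩ | ⟨f, hf, q1, q2⟩
      · obtain ⟨q, hq1, hq2⟩ := exists_pentagon' hn T hit htj hc hf s1 s2 p1 q1 q2 4 hx hy
          (Or.inr ⟨rfl, rfl⟩)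
        refine ⟨q, hq1, _, hq2, ?_⟩
        simp only [Fin.lt_def] at *; omega
      · obtain ⟨q, hq1, hq2⟩ := exists_pentagon' hn T hf hit htj hc q1 s1 s2 p1 q2 2 hx hy
          (Or.inr ⟨rfl, rfl⟩)
        refine ⟨q, hq1, _, hq2, ?_⟩
        simp only [Fin.lt_def] at *; omega
    · have hy : (c, j) ∈ T.val := by
        refine p2.mem ⟨?_, ?_⟩
        · simp only [Fin.lt_def] at *; omega
        · rintro ⟨c1, c2⟩
          have cr5 : (k, l) ∈ T.val → ¬ Cross (k, l) (c, i) := fun h => p1.not_cross (T.2.2.1 _ h)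
          have r2' : k.val + 1 = l.val ∨ (k, l) ∈ T.val := by
            rcases r2 with h | h | h
            · exact Or.inl h
            · omega
            · exact Or.inr h
          have r2'' := r2'.imp_right cr5
          clear r1 r2 r2' cr5 p1 p2 s1 s2 hroot hx
          simp only [ne_eq, Prod.mk.injEq, Fin.ext_iff, Cross, Fin.lt_def, IsDiagonal] at *
          omega
      rcases T.2.exists_parent hn3 hy with ⟨f, hf, q1, q2⟩ | ⟨f, hf, q1, q2⟩
      · obtain ⟨q, hq1, hq2⟩ := exists_pentagon' hn T hc hit htj hf p1 s1 s2 q1 q2 3 hx hy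
          (Or.inl ⟨rfl, rfl⟩)
        refine ⟨q, hq1, _, hq2, ?_⟩
        simp only [Fin.lt_def] at *; omega
      · obtain ⟨q, hq1, hq2⟩ := exists_pentagon' hn T hf hc hit htj q1 p1 s1 s2 q2 1 hx hy
          (Or.inl ⟨rfl, rfl⟩)
        refine ⟨q, hq1, _, hq2, ?_⟩
        simp only [Fin.lt_def] at *; omega
  -- The exceptional `x₀` is a side of the root triangle. If both lower sides of that triangle are
  -- diagonals, `(k, l)` is paired with `x₀ = (o, k)`; every other diagonal is paired with the long
  -- side of the triangle above it.
  by_cases hk : k.val = 1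
  · refine ⟨(k, l), r2.mem ⟨by simp only; omega, by simp only; omega⟩, fun x hx hne => ?_⟩
    obtain ⟨q, hq, y, hy, hlt⟩ := main x hx (fun h => by
      have := (T.2.1 _ hx).1
      rw [h] at this
      simp only at this
      omega) hne
    exact ⟨q, hq, y, hy, Or.inr hlt⟩
  · have hx₀ : (o, k) ∈ T.val := r1.mem ⟨by simp only; omega, by simp only; omega⟩
    refine ⟨(o, k), hx₀, fun x hx hne => ?_⟩
    by_cases hxk : x = (k, l)
    · subst hxk
      obtain ⟨t, ht1, ht2, s1, s2⟩ := T.2.exists_apex hn3 (Or.inr (Or.inr hx)) (T.2.1 _ hx).1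
      obtain ⟨t', ht1', ht2', s1', s2'⟩ :=
        T.2.exists_apex hn3 (Or.inr (Or.inr hx₀)) (T.2.1 _ hx₀).1
      obtain ⟨q, hq1, hq2⟩ := exists_pentagon' hn T ht1' ht2' ht1 ht2 s1' s2' s1 s2 hroot 0 hx hx₀
        (Or.inr ⟨rfl, rfl⟩)
      exact ⟨q, hq1, _, hq2, Or.inl rfl⟩
    · obtain ⟨q, hq, y, hy, hlt⟩ := main x hx hne hxk
      exact ⟨q, hq, y, hy, Or.inr hlt⟩

theorem le_card_pentagons (hn : 5 ≤ n) (T : Triangulation n) :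
    n - 4 ≤ (Finset.univ.filter fun q : Pentagon n × Fin 5 => q.1.vertex q.2 = T).card := by
  obtain ⟨x₀, hx₀, h⟩ := exists_pentagon_of_mem hn T
  obtain ⟨q₀⟩ : Nonempty (Pentagon n × Fin 5) := by
    have : 1 < T.val.card := by have := T.2.2.2; omega
    obtain ⟨x, hx, hne⟩ := Finset.exists_mem_ne this x₀
    exact ⟨(h x hx hne).choose⟩
  have : Nonempty (Fin n × Fin n) := ⟨x₀⟩
  have : Nonempty (Pentagon n × Fin 5) := ⟨q₀⟩
  choose! q hq y hy hlt using h
  have hcard : (T.val.erase x₀).card = n - 4 := by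
    rw [Finset.card_erase_of_mem hx₀, T.2.2.2]; omega
  rw [← hcard]
  refine Finset.card_le_card_of_injOn q (fun x hx => ?_) ?_
  · have hx' := Finset.mem_erase.1 (Finset.mem_coe.1 hx)
    simp [hq x hx'.2 hx'.1]
  · intro x hx x' hx' heq
    obtain ⟨hx1, hx2⟩ := Finset.mem_erase.1 (Finset.mem_coe.1 hx)
    obtain ⟨hx1', hx2'⟩ := Finset.mem_erase.1 (Finset.mem_coe.1 hx')
    -- If two diagonals gave the same pair, each would be the partner of the other; neither is `x₀`,
    -- so each would be strictly longer than the other.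
    by_contra hne
    have e1 := hy x hx2 hx1
    have e2 := hy x' hx2' hx1'
    rw [heq, e2] at e1
    have m1 : x' ∈ ({x, y x} : Finset (Fin n × Fin n)) := by rw [← e1]; simp
    have m2 : x ∈ ({x', y x'} : Finset (Fin n × Fin n)) := by rw [e1]; simp
    simp only [Finset.mem_insert, Finset.mem_singleton] at m1 m2
    have y1 : x' = y x := m1.resolve_left (Ne.symm hne)
    have y2 : x = y x' := m2.resolve_left hne
    have l1 := (hlt x hx2 hx1).resolve_left (fun h => hx1' (y1.trans h))
    have l2 := (hlt x' hx2' hx1').resolve_left (fun h => hx1 (y2.trans h))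
    rw [← y1] at l1
    rw [← y2] at l2
    omega

/-! ### Counting the faces through a flip. -/

/-- The possible sides of the quadrilateral with diagonals `x` and `y`. -/
def quadrilateralSides (x y : Fin n × Fin n) : Finset (Fin n × Fin n) :=
  {(min x.1 y.1, max x.1 y.1), (min x.1 y.2, max x.1 y.2), (min x.2 y.1, max x.2 y.1),
    (min x.2 y.2, max x.2 y.2)}

theorem card_quadrilateralSides_le (x y : Fin n × Fin n) : (quadrilateralSides x y).card ≤ 4 :=
  Finset.card_le_four

theorem quadrilateralSides_comm (x y : Fin n × Fin n) :
    quadrilateralSides x y = quadrilateralSides y x := by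
  unfold quadrilateralSides
  simp only [min_comm y.1, min_comm y.2, max_comm y.1, max_comm y.2]
  ext d; simp only [Finset.mem_insert, Finset.mem_singleton]; tauto

theorem pentagonDiagonal_mem_quadrilateralSides {v : Fin 5 → Fin n} (h : StrictMono v)
    (i : Fin 5) : pentagonDiagonal v (i + 1) ∈
      quadrilateralSides (pentagonDiagonal v i) (pentagonDiagonal v (i + 2)) := by
  have := StrictMono.pentagon h
  unfold quadrilateralSides
  rcases pentagonDiagonal_cases v i with
      ⟨hi, hi0, hi1, hi2⟩ | ⟨hi, hi0, hi1, hi2⟩ | ⟨hi, hi0, hi1, hi2⟩ |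
      ⟨hi, hi0, hi1, hi2⟩ | ⟨hi, hi0, hi1, hi2⟩ <;>
    rw [hi0, hi1, hi2] <;>
    simp only [Finset.mem_insert, Finset.mem_singleton, Prod.mk.injEq, Fin.ext_iff, Fin.coe_min,
      Fin.coe_max] <;> omega

/-- The sides `k` and `l` form the ear cut off by diagonal `i + 1`; they meet at the one vertex not
on the quadrilateral with diagonals `i` and `i + 2`. -/
theorem pentagonDiagonal_side_cases (v : Fin 5 → Fin n) (i : Fin 5) : ∃ k l,
    (i.val = 0 ∧ pentagonDiagonal v i = (v 0, v 2) ∧ pentagonDiagonal v (i + 1) = (v 2, v 4) ∧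
      pentagonDiagonal v (i + 2) = (v 1, v 4) ∧
      pentagonSide v k = (v 2, v 3) ∧ pentagonSide v l = (v 3, v 4)) ∨
    (i.val = 1 ∧ pentagonDiagonal v i = (v 2, v 4) ∧ pentagonDiagonal v (i + 1) = (v 1, v 4) ∧
      pentagonDiagonal v (i + 2) = (v 1, v 3) ∧
      pentagonSide v k = (v 0, v 1) ∧ pentagonSide v l = (v 0, v 4)) ∨
    (i.val = 2 ∧ pentagonDiagonal v i = (v 1, v 4) ∧ pentagonDiagonal v (i + 1) = (v 1, v 3) ∧
      pentagonDiagonal v (i + 2) = (v 0, v 3) ∧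
      pentagonSide v k = (v 1, v 2) ∧ pentagonSide v l = (v 2, v 3)) ∨
    (i.val = 3 ∧ pentagonDiagonal v i = (v 1, v 3) ∧ pentagonDiagonal v (i + 1) = (v 0, v 3) ∧
      pentagonDiagonal v (i + 2) = (v 0, v 2) ∧
      pentagonSide v k = (v 3, v 4) ∧ pentagonSide v l = (v 0, v 4)) ∨
    (i.val = 4 ∧ pentagonDiagonal v i = (v 0, v 3) ∧ pentagonDiagonal v (i + 1) = (v 0, v 2) ∧
      pentagonDiagonal v (i + 2) = (v 2, v 4) ∧
      pentagonSide v k = (v 0, v 1) ∧ pentagonSide v l = (v 1, v 2)) := by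
  match i with
  | 0 => exact ⟨2, 3, Or.inl ⟨rfl, rfl, rfl, rfl, rfl, rfl⟩⟩
  | 1 => exact ⟨0, 4, Or.inr (Or.inl ⟨rfl, rfl, rfl, rfl, rfl, rfl⟩)⟩
  | 2 => exact ⟨1, 2, Or.inr (Or.inr (Or.inl ⟨rfl, rfl, rfl, rfl, rfl, rfl⟩))⟩
  | 3 => exact ⟨3, 4, Or.inr (Or.inr (Or.inr (Or.inl ⟨rfl, rfl, rfl, rfl, rfl, rfl⟩)))⟩
  | 4 => exact ⟨0, 1, Or.inr (Or.inr (Or.inr (Or.inr ⟨rfl, rfl, rfl, rfl, rfl, rfl⟩)))⟩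

/-- A pentagon with non-crossing surroundings is determined by three consecutive diagonals. -/
theorem eq_of_pentagonDiagonal_eq {v w : Fin 5 → Fin n} (hv : StrictMono v) (hw : StrictMono w)
    (hc : ∀ k l, ¬ Cross (pentagonSide v k) (pentagonSide w l))
    {i j : Fin 5} (h1 : pentagonDiagonal v (i + 1) = pentagonDiagonal w (j + 1))
    (h : (pentagonDiagonal v i = pentagonDiagonal w j ∧
        pentagonDiagonal v (i + 2) = pentagonDiagonal w (j + 2)) ∨
      (pentagonDiagonal v i = pentagonDiagonal w (j + 2) ∧
        pentagonDiagonal v (i + 2) = pentagonDiagonal w j)) : v = w ∧ i = j := by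
  have a := StrictMono.pentagon hv
  have b := StrictMono.pentagon hw
  have e : v = w ↔ (v 0).val = (w 0).val ∧ (v 1).val = (w 1).val ∧ (v 2).val = (w 2).val ∧
      (v 3).val = (w 3).val ∧ (v 4).val = (w 4).val := by
    constructor
    · rintro rfl; simp
    · rintro ⟨h0, h1, h2, h3, h4⟩
      funext k
      fin_cases k <;> apply Fin.ext <;> assumption
  rw [e, Fin.ext_iff]
  obtain ⟨k, l, hvi⟩ := pentagonDiagonal_side_cases v i
  obtain ⟨k', l', hwj⟩ := pentagonDiagonal_side_cases w j
  -- The shared diagonals fix four vertices. Two ears with distinct tips over the same chord would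
  -- have crossing sides, so the fifth vertices agree too.
  have c1 := hc k k'
  have c2 := hc k l'
  have c3 := hc l k'
  have c4 := hc l l'
  clear e hv hw hc
  rcases hvi with
      ⟨hi, hi0, hi1, hi2, hi3, hi4⟩ | ⟨hi, hi0, hi1, hi2, hi3, hi4⟩ |
      ⟨hi, hi0, hi1, hi2, hi3, hi4⟩ | ⟨hi, hi0, hi1, hi2, hi3, hi4⟩ |
      ⟨hi, hi0, hi1, hi2, hi3, hi4⟩ <;>
    rcases hwj with
      ⟨hj, hj0, hj1, hj2, hj3, hj4⟩ | ⟨hj, hj0, hj1, hj2, hj3, hj4⟩ |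
      ⟨hj, hj0, hj1, hj2, hj3, hj4⟩ | ⟨hj, hj0, hj1, hj2, hj3, hj4⟩ |
      ⟨hj, hj0, hj1, hj2, hj3, hj4⟩ <;>
    rw [hi1, hj1] at h1 <;> rw [hi0, hi2, hj0, hj2] at h <;>
    rw [hi3, hj3] at c1 <;> rw [hi3, hj4] at c2 <;> rw [hi4, hj3] at c3 <;>
    rw [hi4, hj4] at c4 <;>
    clear hi0 hi1 hi2 hi3 hi4 hj0 hj1 hj2 hj3 hj4 <;>
    simp only [Prod.mk.injEq, Fin.ext_iff, Cross, Fin.lt_def] at h h1 c1 c2 c3 c4 <;>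
    rcases h with h | h <;> omega

/-- A face through the flip is determined by the diagonal `i + 1` common to both triangulations,
which is a side of the flip quadrilateral. Listing pentagon vertices in increasing order ensures
that rotations and reflections of a face are not counted separately. -/
theorem card_pentagons_le (S T : Triangulation n) :
    (Finset.univ.filter fun q : Pentagon n × Fin 5 =>
      (q.1.vertex q.2 = S ∧ q.1.vertex (q.2 + 1) = T) ∨
      (q.1.vertex q.2 = T ∧ q.1.vertex (q.2 + 1) = S)).card ≤ 4 := by
  set s := Finset.univ.filter fun q : Pentagon n × Fin 5 =>
      (q.1.vertex q.2 = S ∧ q.1.vertex (q.2 + 1) = T) ∨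
      (q.1.vertex q.2 = T ∧ q.1.vertex (q.2 + 1) = S) with hs
  rcases s.eq_empty_or_nonempty with h0 | ⟨q₀, hq₀⟩
  · simp [h0]
  have key : ∀ q ∈ s,
      (S.val \ T.val = {q.1.diagonal q.2} ∧ T.val \ S.val = {q.1.diagonal (q.2 + 2)}) ∨
      (T.val \ S.val = {q.1.diagonal q.2} ∧ S.val \ T.val = {q.1.diagonal (q.2 + 2)}) := by
    intro q hq
    rcases (Finset.mem_filter.1 hq).2 with ⟨rfl, rfl⟩ | ⟨rfl, rfl⟩
    · exact Or.inl ⟨q.1.vertex_sdiff _, q.1.vertex_succ_sdiff _⟩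
    · exact Or.inr ⟨q.1.vertex_sdiff _, q.1.vertex_succ_sdiff _⟩
  obtain ⟨x, y, hx, hy⟩ : ∃ x y, S.val \ T.val = {x} ∧ T.val \ S.val = {y} := by
    rcases key q₀ hq₀ with ⟨h1, h2⟩ | ⟨h1, h2⟩
    · exact ⟨_, _, h1, h2⟩
    · exact ⟨_, _, h2, h1⟩
  simp only [hx, hy, Finset.singleton_inj] at key
  refine (Finset.card_le_card_of_injOn (t := quadrilateralSides x y)
    (fun q => q.1.diagonal (q.2 + 1)) (fun q hq => ?_) ?_).trans (card_quadrilateralSides_le x y)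
  · have := pentagonDiagonal_mem_quadrilateralSides q.1.2.strictMono q.2
    rcases key q hq with ⟨h1, h2⟩ | ⟨h1, h2⟩
    · rw [h1, h2]; exact this
    · rw [h1, h2, quadrilateralSides_comm]; exact this
  · intro q hq q' hq' heq
    have h1 := key q hq
    have h2 := key q' hq'
    -- Equal common diagonals give equal `W`, so the sides of both pentagons are edges of one
    -- noncrossing family.
    have hW : ∀ r ∈ s, r.1.1.2 = (S.val ∩ T.val).erase (r.1.diagonal (r.2 + 1)) := by
      intro r hr
      have n0 := r.1.2.notMem r.2
      have n1 := r.1.2.notMem (r.2 + 1)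
      have e1 : r.1.1.2 = ((r.1.vertex r.2).val ∩ (r.1.vertex (r.2 + 1)).val).erase
          (r.1.diagonal (r.2 + 1)) := by
        rw [← Finset.sdiff_sdiff_self_left, r.1.vertex_sdiff]
        ext d
        simp only [Pentagon.vertex, Finset.mem_erase, Finset.mem_sdiff, Finset.mem_insert,
          Finset.mem_singleton]
        constructor
        · intro hd
          exact ⟨by rintro rfl; exact n1 hd, Or.inr (Or.inr hd), by rintro rfl; exact n0 hd⟩
        · tauto
      rcases (Finset.mem_filter.1 hr).2 with ⟨rfl, rfl⟩ | ⟨rfl, rfl⟩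
      · exact e1
      · rw [Finset.inter_comm]; exact e1
    have hWW : q.1.1.2 = q'.1.1.2 := by
      rw [hW q hq, hW q' hq']
      exact congrArg _ heq
    obtain ⟨hv, hi⟩ := eq_of_pentagonDiagonal_eq q.1.2.strictMono q'.1.2.strictMono
      (fun k l => q'.1.2.not_cross_side (fun e he hx => q.1.2.not_cross_side
        (fun d hd => q.1.2.not_cross e (hWW ▸ he) d hd) k hx.symm) l) heq (by
      rcases h1 with ⟨h1, h1'⟩ | ⟨h1, h1'⟩ <;> rcases h2 with ⟨h2, h2'⟩ | ⟨h2, h2'⟩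
      · exact Or.inl ⟨h1.symm.trans h2, h1'.symm.trans h2'⟩
      · exact Or.inr ⟨h1.symm.trans h2', h1'.symm.trans h2⟩
      · exact Or.inr ⟨h1.symm.trans h2', h1'.symm.trans h2⟩
      · exact Or.inl ⟨h1.symm.trans h2, h1'.symm.trans h2'⟩)
    exact Prod.ext (Subtype.ext (Prod.ext hv hWW)) hi

/-- The fan of diagonals from one vertex. -/
theorem nonempty_triangulation (hn : 3 ≤ n) : Nonempty (Triangulation n) := by
  let o : Fin n := ⟨0, by omega⟩
  let m : Fin n := ⟨1, by omega⟩
  let l : Fin n := ⟨n - 1, by omega⟩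
  refine ⟨⟨(Finset.Ioo m l).image fun j => (o, j), ?_, ?_, ?_⟩⟩
  · intro d hd
    obtain ⟨j, hj, rfl⟩ := Finset.mem_image.1 hd
    simp only [Finset.mem_Ioo, Fin.lt_def, m, l] at hj
    simp only [IsDiagonal, o]
    omega
  · intro d hd e he
    obtain ⟨j, hj, rfl⟩ := Finset.mem_image.1 hd
    obtain ⟨k, hk, rfl⟩ := Finset.mem_image.1 he
    simp [Cross]
  · rw [Finset.card_image_of_injective _ (Prod.mk_right_injective o), Fin.card_Ioo]
    simp only [m, l]
    omega

end Pentagons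

end Associahedron

open Associahedron in
theorem mainTheorem3 (n : ℕ) (hn : 5 ≤ n) :
    ∃ μ : ℝ, Associahedron.IsSmallestEigenvalue (Associahedron.associahedronGraph n) μ ∧
      -((5 + Real.sqrt 5) / 8) * ((n : ℝ) - 3) - (3 - Real.sqrt 5) / 8 ≤ μ := by
  have : Nonempty (Triangulation n) := nonempty_triangulation (by omega)
  refine exists_isSmallestEigenvalue_ge _ fun f => ?_
  have h := (associahedronGraph n).adjMatrix_form_ge_of_five_cycles Pentagon.vertex
    Pentagon.adj (le_card_pentagons hn) (fun S T _ => card_pentagons_le S T)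
    (degree_le (by omega)) f
  -- The truncated `n - 4` and `n - 3` become real subtractions; dividing by 4 leaves `(3 - √5)/8 *
  -- (n - 4) - (n - 3)`, the stated bound.
  rw [Nat.cast_sub (by omega), Nat.cast_sub (by omega)] at h
  push_cast at h
  linarith
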